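/- Let $G$ be a discrete group and $\Gamma\le G$ a subgroup such that $(G,\Gamma)$ is a Hecke pair, i.e. every double coset $\Gamma g\Gamma$ is a union of finitely many left cosets of $\Gamma$. Let $(\overline{G},\overline{\Gamma})$ be a Schlichting completion of $(G,\Gamma)$, meaning that $\overline{G}$ is a totally disconnected locally compact Hausdorff group, $\overline{\Gamma}\le\overline{G}$ is a compact open subgroup, and there is a homomorphism $\iota:G\to\overline{G}$ such that $\iota(G)$ is dense in $\overline{G}$, $\iota(\Gamma)$ is dense in $\overline{\Gamma}$ and $\iota^{-1}(\overline{\Gamma})=\Gamma$. Suppose that at least one of the following holds: (a) $\overline{G}$ has Kazhdan's property (T): every strongly continuous unitary representation $\pi$ of $\overline{G}$ on a Hilbert space such that for every compact $Q\subseteq\overline{G}$ and every $\varepsilon>0$ there is a unit vector $\xi$ with $\|\pi(g)\xi-\xi\|<\varepsilon$ for all $g\in Q$, has a nonzero $\overline{G}$-invariant vector; (b) the Hecke pair $(G,\Gamma)$ has property (T): every unitary representation $\pi$ of $G$ such that for every finite $Q\subseteq G/\Gamma$ and every $\varepsilon>0$ there is a $\Gamma$-invariant unit vector $\xi$ with $\|\pi(g)\xi-\xi\|<\varepsilon$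 for all $g$ with $g\Gamma\in Q$, has a nonzero $G$-invariant vector. Let $\mu$ be the left Haar measure of $\overline{G}$ with $\mu(\overline{\Gamma})=1$, let $C^*(\overline{G})$ be the full group $C^*$-algebra of $\overline{G}$, i.e. the completion of the convolution algebra $C_c(\overline{G})$ in the norm $\|f\|=\sup_\pi\|\pi(f)\|$, where $\pi$ runs over the strongly continuous unitary representations of $\overline{G}$ and $\pi(f)=\int f(g)\pi(g)\,d\mu(g)$, and let $p_0\in C^*(\overline{G})$ be the projection given by the characteristic function of $\overline{\Gamma}$. For a $*$-algebra $A$ let $\widehat{A}$ be the set of unitary equivalence classes of (nonzero) topologically irreducible $*$-representations of $A$ on Hilbert spaces, with the hull-kernel topology: its closed sets are the sets $\{[\sigma]: I\subseteq\ker\sigma\}$ for $I\subseteq A$. The trivial representation of $p_0C^*(\overline{G})p_0$ is the restriction to $p_0C^*(\overline{G})p_0$ of the one-dimensional representation of $C^*(\overline{G})$ that extends $f\mapsto\int f\,d\mu$. Then the trivial representation of $p_0C^*(\overline{G})p_0$ is an isolated point of $\bigl(p_0C^*(\overline{G})p_0\bigr)^{\wedge}$, i.e. its class forms an open subset. -/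

import Mathlib

open MeasureTheory
open scoped ENNReal CompactlySupported InnerProductSpace

universe u w

set_option linter.unusedSectionVars false

noncomputable section

/-! ### Unitary representations and property (T) -/

/-- A (strongly continuous) unitary representation of a topological group on a Hilbert space. -/
structure UnitaryRep (G : Type u) [Group G] [TopologicalSpace G] : Type (u + 1) where
  space : Type u
  [instNormed : NormedAddCommGroup space]
  [instInner : InnerProductSpace ℂ space]
  [instComplete : CompleteSpace space]
  toHom : G →* unitary (space →L[ℂ] space)
  continuous_orbit : ∀ ξ : space, Continuous fun g => (toHom g : space →L[ℂ] space) ξ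

attribute [instance] UnitaryRep.instNormed UnitaryRep.instInner UnitaryRep.instComplete

namespace UnitaryRep

variable {G : Type u} [Group G] [TopologicalSpace G]

/-- The operator `π(g)`. -/
def op (π : UnitaryRep G) (g : G) : π.space →L[ℂ] π.space := (π.toHom g : π.space →L[ℂ] π.space)

/-- `π` has a nonzero `G`-invariant vector. -/
def HasInvariantVector (π : UnitaryRep G) : Prop :=
  ∃ ξ : π.space, ξ ≠ 0 ∧ ∀ g, π.op g ξ = ξ

/-- `π` has almost invariant vectors: `(ε, Q)`-invariant unit vectors for all `ε > 0` and all
compact `Q ⊆ G`. -/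
def HasAlmostInvariantVectors (π : UnitaryRep G) : Prop :=
  ∀ Q : Set G, IsCompact Q → ∀ ε : ℝ, 0 < ε →
    ∃ ξ : π.space, ‖ξ‖ = 1 ∧ ∀ g ∈ Q, ‖π.op g ξ - ξ‖ < ε

/-- `π` has `Γ`-invariant almost `G`-invariant vectors: for all `ε > 0` and all compact
`Q ⊆ G/Γ` there is a `Γ`-invariant unit vector that is moved by less than `ε` by every `g` with
`gΓ ∈ Q`. -/
def HasAlmostInvariantVectorsRel (π : UnitaryRep G) (Γ : Subgroup G) : Prop :=
  ∀ Q : Set (G ⧸ Γ), IsCompact Q → ∀ ε : ℝ, 0 < ε →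
    ∃ ξ : π.space, ‖ξ‖ = 1 ∧ (∀ h ∈ Γ, π.op h ξ = ξ) ∧
      ∀ g : G, (g : G ⧸ Γ) ∈ Q → ‖π.op g ξ - ξ‖ < ε

end UnitaryRep

/-- Kazhdan's property (T) for a topological group. -/
def HasPropertyT (G : Type u) [Group G] [TopologicalSpace G] : Prop :=
  ∀ π : UnitaryRep G, π.HasAlmostInvariantVectors → π.HasInvariantVector

/-- Property (T) for a pair `(G, Γ)`. -/
def PairHasPropertyT (G : Type u) [Group G] [TopologicalSpace G] (Γ : Subgroup G) : Prop :=
  ∀ π : UnitaryRep G, π.HasAlmostInvariantVectorsRel Γ → π.HasInvariantVector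

/-! ### Hecke pairs and the Schlichting completion -/

/-- `(G, Γ)` is a Hecke pair: every double coset `ΓgΓ` contains only finitely many left cosets. -/
def IsHeckePair {G : Type u} [Group G] (Γ : Subgroup G) : Prop :=
  ∀ g : G, ((QuotientGroup.mk : G → G ⧸ Γ) '' DoubleCoset.doubleCoset g (Γ : Set G) Γ).Finite

/-- The pair `(Gb, Γb)`, with the homomorphism `ι : G → Gb`, is a Schlichting completion of
`(G, Γ)`. It is used for a totally disconnected locally compact group `Gb`. The homomorphism `ι`
factors through an embedding of the reduction of `(G, Γ)`, so it need not be injective. That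
`(Gb, Γb)` be reduced, which singles out one pair up to isomorphism, is not demanded. -/
structure IsSchlichtingCompletion {G Gb : Type u} [Group G] (Γ : Subgroup G) [Group Gb]
    [TopologicalSpace Gb] (Γb : Subgroup Gb) (ι : G →* Gb) : Prop where
  isCompact : IsCompact (Γb : Set Gb)
  isOpen : IsOpen (Γb : Set Gb)
  denseRange : DenseRange ι
  closure_image : closure (ι '' (Γ : Set G)) = (Γb : Set Gb)
  comap_eq : Γb.comap ι = Γ

/-! ### The spectrum of a `*`-algebra with the hull-kernel topology -/

section Spectrum

variable (A : Type w) [NonUnitalRing A] [StarRing A] [Module ℂ A]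

/-- A (nonzero) topologically irreducible `*`-representation of `A` on a Hilbert space. -/
structure IrreducibleRep : Type (w + 1) where
  space : Type w
  [instNormed : NormedAddCommGroup space]
  [instInner : InnerProductSpace ℂ space]
  [instComplete : CompleteSpace space]
  toHom : A →⋆ₙₐ[ℂ] (space →L[ℂ] space)
  nonzero : ∃ a, toHom a ≠ 0
  irreducible : ∀ K : Submodule ℂ space, IsClosed (K : Set space) →
    (∀ a, ∀ ξ ∈ K, toHom a ξ ∈ K) → K = ⊥ ∨ K = ⊤

attribute [instance] IrreducibleRep.instNormed IrreducibleRep.instInner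
  IrreducibleRep.instComplete

variable {A}

namespace IrreducibleRep

/-- The kernel of an irreducible `*`-representation. -/
def ker (π : IrreducibleRep A) : TwoSidedIdeal A := TwoSidedIdeal.ker π.toHom

theorem mem_ker (π : IrreducibleRep A) (a : A) : a ∈ π.ker ↔ π.toHom a = 0 :=
  TwoSidedIdeal.mem_ker _

/-- Unitary equivalence. -/
def UnitarilyEquiv (π σ : IrreducibleRep A) : Prop :=
  ∃ U : π.space ≃ₗᵢ[ℂ] σ.space, ∀ a ξ, U (π.toHom a ξ) = σ.toHom a (U ξ)

theorem UnitarilyEquiv.ker_eq {π σ : IrreducibleRep A} (h : π.UnitarilyEquiv σ) :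
    π.ker = σ.ker := by
  obtain ⟨U, hU⟩ := h
  ext a
  rw [mem_ker, mem_ker]
  constructor
  · intro ha
    ext ξ
    have := hU a (U.symm ξ)
    simpa [ha] using this.symm
  · intro ha
    ext ξ
    have := hU a ξ
    simpa [ha] using this

/-- The kernel of an irreducible `*`-representation is prime. -/
theorem ker_prime (π : IrreducibleRep A) {a b : A} (h : ∀ c, a * c * b ∈ π.ker) :
    a ∈ π.ker ∨ b ∈ π.ker := by
  simp only [mem_ker, map_mul] at h ⊢
  -- the vectors killed by the whole algebra
  have hdeg : ∀ η : π.space, (∀ c, π.toHom c η = 0) → η = 0 := by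
    let K : Submodule ℂ π.space := ⨅ c : A, LinearMap.ker (π.toHom c : π.space →ₗ[ℂ] π.space)
    have hK : ∀ η, η ∈ K ↔ ∀ c, π.toHom c η = 0 := fun η => by simp [K]
    have hcl : IsClosed (K : Set π.space) := by
      have : (K : Set π.space) = ⋂ c : A, {η | π.toHom c η = 0} := by
        ext η
        simp [hK]
      rw [this]
      exact isClosed_iInter fun c => isClosed_eq (π.toHom c).continuous continuous_const
    rcases π.irreducible K hcl (fun c ξ hξ => by
      rw [(hK ξ).1 hξ c]; exact K.zero_mem) with hb | ht
    · intro η hη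
      simpa [hb] using (hK η).2 hη
    · obtain ⟨c, hc⟩ := π.nonzero
      exact absurd (ContinuousLinearMap.ext fun η =>
        (hK η).1 (ht ▸ Submodule.mem_top) c) hc
  by_cases hb : π.toHom b = 0
  · exact Or.inr hb
  left
  obtain ⟨ξ, hξ⟩ : ∃ ξ, π.toHom b ξ ≠ 0 := by
    by_contra! hcon
    exact hb (ContinuousLinearMap.ext hcon)
  -- the closed invariant subspace of all vectors `η` with `π(a c) η = 0` for all `c`, and
  -- `π(a) η = 0`
  let K : Submodule ℂ π.space := LinearMap.ker (π.toHom a : π.space →ₗ[ℂ] π.space) ⊓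
    ⨅ c : A, LinearMap.ker (π.toHom (a * c) : π.space →ₗ[ℂ] π.space)
  have hK : ∀ η, η ∈ K ↔ π.toHom a η = 0 ∧ ∀ c, π.toHom (a * c) η = 0 := fun η => by simp [K]
  have hcl : IsClosed (K : Set π.space) := by
    have : (K : Set π.space) =
        {η | π.toHom a η = 0} ∩ ⋂ c : A, {η | π.toHom (a * c) η = 0} := by
      ext η
      simp [hK]
    rw [this]
    exact (isClosed_eq (π.toHom a).continuous continuous_const).inter
      (isClosed_iInter fun c => isClosed_eq (π.toHom (a * c)).continuous continuous_const)
  have hzero : ∀ c η, π.toHom (a * c) (π.toHom b η) = 0 := fun c η => by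
    have := congrArg (fun T : π.space →L[ℂ] π.space => T η) (h c)
    simpa [map_mul] using this
  rcases π.irreducible K hcl (fun c η hη => by
    rw [hK] at hη ⊢
    refine ⟨by simpa [map_mul] using hη.2 c, fun d => ?_⟩
    have := hη.2 (d * c)
    simpa [map_mul] using this) with hb' | ht
  · exfalso
    apply hξ
    apply hdeg
    intro c
    have hmem : π.toHom c (π.toHom b ξ) ∈ K := by
      rw [hK]
      refine ⟨by simpa [map_mul] using hzero c ξ, fun d => ?_⟩
      have := hzero (d * c) ξ
      simpa [map_mul] using this
    simpa [hb'] using hmem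
  · exact ContinuousLinearMap.ext fun η => ((hK η).1 (ht ▸ Submodule.mem_top)).1

end IrreducibleRep

variable (A)

instance irreducibleRepSetoid : Setoid (IrreducibleRep A) where
  r := IrreducibleRep.UnitarilyEquiv
  iseqv :=
    { refl := fun π => ⟨LinearIsometryEquiv.refl ℂ _, fun _ _ => rfl⟩
      symm := by
        rintro π σ ⟨U, hU⟩
        exact ⟨U.symm, fun a ξ => U.injective (by simp [hU])⟩
      trans := by
        rintro π σ τ ⟨U, hU⟩ ⟨V, hV⟩
        exact ⟨U.trans V, fun a ξ => by simp [hU, hV]⟩ }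

/-- The primitive ideal space: kernels of topologically irreducible `*`-representations. -/
def Prim : Type w := {P : TwoSidedIdeal A // ∃ π : IrreducibleRep A, π.ker = P}

variable {A} in
/-- The hull of a set `I`: all primitive ideals that contain it. -/
def hull (I : Set A) : Set (Prim A) := {P | ∀ a ∈ I, a ∈ P.1}

/-- The hull-kernel topology: the closed sets are the hulls. -/
instance : TopologicalSpace (Prim A) :=
  TopologicalSpace.ofClosed (Set.range (hull (A := A)))
    (by
      refine ⟨Set.univ, Set.eq_empty_iff_forall_notMem.2 ?_⟩
      rintro ⟨_, π, rfl⟩ h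
      obtain ⟨a, ha⟩ := π.nonzero
      exact ha ((π.mem_ker a).1 (h a trivial)))
    (by
      intro T hT
      refine ⟨⋃₀ {I | hull I ∈ T}, ?_⟩
      ext P
      simp only [hull, Set.mem_sUnion, Set.mem_ofPred_eq, Set.mem_sInter]
      constructor
      · intro h S hS
        obtain ⟨I, rfl⟩ := hT hS
        exact fun a ha => h a ⟨I, hS, ha⟩
      · rintro h a ⟨I, hI, ha⟩
        exact h _ hI a ha)
    (by
      rintro _ ⟨I, rfl⟩ _ ⟨J, rfl⟩
      refine ⟨{x | ∃ a ∈ I, ∃ b ∈ J, ∃ c, x = a * c * b}, ?_⟩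
      ext P
      obtain ⟨_, π, rfl⟩ := P
      constructor
      · intro h
        by_cases hI : ∀ a ∈ I, a ∈ π.ker
        · exact Or.inl hI
        · push Not at hI
          obtain ⟨a, haI, ha⟩ := hI
          refine Or.inr fun b hb => ?_
          exact (π.ker_prime fun c => h _ ⟨a, haI, b, hb, c, rfl⟩).resolve_left ha
      · rintro (h | h) x ⟨a, ha, b, hb, c, rfl⟩
        · rw [mul_assoc]
          exact TwoSidedIdeal.mul_mem_right _ _ _ (h a ha)
        · exact TwoSidedIdeal.mul_mem_left _ _ _ (h b hb))

/-- The dual space (spectrum) of `A`: unitary equivalence classes of irreducible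
`*`-representations. -/
def DualSpace : Type (w + 1) := Quotient (irreducibleRepSetoid A)

/-- The canonical map from the dual space to the primitive ideal space. -/
def DualSpace.toPrim : DualSpace A → Prim A :=
  Quotient.lift (fun π => ⟨π.ker, π, rfl⟩) fun _ _ h => Subtype.ext h.ker_eq

/-- The topology of the dual space is pulled back from the primitive ideal space. -/
instance : TopologicalSpace (DualSpace A) :=
  TopologicalSpace.induced (DualSpace.toPrim A) inferInstance

variable {A}

/-- The one-dimensional representation given by a nonzero `*`-homomorphism `χ : A → ℂ`. -/
def IrreducibleRep.ofCharacter (χ : A →⋆ₙₐ[ℂ] ℂ) (hχ : ∃ a, χ a ≠ 0) : IrreducibleRep A where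
  space := EuclideanSpace ℂ PUnit.{w + 1}
  toHom :=
    { toFun := fun a => χ a • ContinuousLinearMap.id ℂ _
      map_smul' := by intro c a; simp [mul_smul]
      map_zero' := by simp
      map_add' := by intro a b; ext; simp [add_mul]
      map_mul' := by intro a b; ext; simp [mul_left_comm, mul_assoc]
      map_star' := by
        intro a
        ext1 ξ
        refine ext_inner_left ℂ fun η => ?_
        rw [ContinuousLinearMap.star_eq_adjoint, ContinuousLinearMap.adjoint_inner_right]
        simp [map_star, inner_smul_left, inner_smul_right] }
  nonzero := by
    obtain ⟨a, ha⟩ := hχ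
    refine ⟨a, fun h => ha ?_⟩
    have := congrArg (fun T : EuclideanSpace ℂ PUnit.{w + 1} →L[ℂ] EuclideanSpace ℂ PUnit.{w + 1} =>
      T (WithLp.toLp 2 fun _ => 1) PUnit.unit) h
    simpa using this
  irreducible := by
    intro K _ _
    have : IsSimpleOrder (Submodule ℂ (EuclideanSpace ℂ PUnit.{w + 1})) :=
      isSimpleModule_iff _ _ |>.1 (isSimpleModule_iff_finrank_eq_one.2 (by simp))
    exact eq_bot_or_eq_top K

end Spectrum

/-! ### The full group `C*`-algebra -/

section GroupCStar

variable {G : Type u} [Group G] [TopologicalSpace G] [MeasurableSpace G] [BorelSpace G]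
  (μ : Measure G) [μ.IsHaarMeasure]

namespace UnitaryRep

theorem norm_op_apply (π : UnitaryRep G) (g : G) (ξ : π.space) : ‖π.op g ξ‖ = ‖ξ‖ := by
  have h : star (π.op g) * π.op g = 1 := Unitary.coe_star_mul_self (π.toHom g)
  exact (ContinuousLinearMap.norm_map_iff_adjoint_comp_self (π.op g)).2 h ξ

theorem integrable_smul_op (π : UnitaryRep G) (f : C_c(G, ℂ)) (ξ : π.space) :
    Integrable (fun g => f g • π.op g ξ) μ :=
  (f.continuous.smul (π.continuous_orbit ξ)).integrable_of_hasCompactSupport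
    f.hasCompactSupport.smul_right

theorem norm_integral_le (π : UnitaryRep G) (f : C_c(G, ℂ)) (ξ : π.space) :
    ‖∫ g, f g • π.op g ξ ∂μ‖ ≤ (∫ g, ‖f g‖ ∂μ) * ‖ξ‖ := by
  refine (norm_integral_le_integral_norm _).trans (le_of_eq ?_)
  simp only [norm_smul, norm_op_apply]
  exact integral_mul_const _ _

/-- The integrated form `π(f) = ∫ f(g) π(g) dμ(g)` of a unitary representation. -/
def integrated (π : UnitaryRep G) (f : C_c(G, ℂ)) : π.space →L[ℂ] π.space :=
  LinearMap.mkContinuous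
    { toFun := fun ξ => ∫ g, f g • π.op g ξ ∂μ
      map_add' := by
        intro ξ η
        simp only [map_add, smul_add]
        exact integral_add (π.integrable_smul_op μ f ξ) (π.integrable_smul_op μ f η)
      map_smul' := by
        intro c ξ
        simp only [map_smul, RingHom.id_apply, smul_comm _ c]
        exact integral_smul c _ }
    (∫ g, ‖f g‖ ∂μ) (π.norm_integral_le μ f)

theorem integrated_apply (π : UnitaryRep G) (f : C_c(G, ℂ)) (ξ : π.space) :
    π.integrated μ f ξ = ∫ g, f g • π.op g ξ ∂μ := rfl

theorem norm_integrated_le (π : UnitaryRep G) (f : C_c(G, ℂ)) :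
    ‖π.integrated μ f‖ ≤ ∫ g, ‖f g‖ ∂μ :=
  LinearMap.mkContinuous_norm_le _ (integral_nonneg fun _ => norm_nonneg _) _

variable (G) in
/-- The trivial representation of `G`, on a one-dimensional Hilbert space. -/
def trivialRep : UnitaryRep G where
  space := EuclideanSpace ℂ PUnit.{u + 1}
  toHom := 1
  continuous_orbit := fun _ => continuous_const

end UnitaryRep

variable (G) in
/-- The `C*`-algebra of all bounded families of operators, one on the space of each unitary
representation of `G`. -/
abbrev BoundedFamilies : Type (u + 1) := lp (fun π : UnitaryRep G => π.space →L[ℂ] π.space) ∞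

/-- The universal representation of `C_c(G)`: the function `f` acts by the family of all `π(f)`. -/
def universalRep (f : C_c(G, ℂ)) : BoundedFamilies G :=
  ⟨fun π => π.integrated μ f, memℓp_infty ⟨∫ g, ‖f g‖ ∂μ, by
    rintro _ ⟨π, rfl⟩
    exact π.norm_integrated_le μ f⟩⟩

/-- The `C*`-algebra generated by the image of `C_c(G)` under the universal representation. -/
def groupCStarSubalgebra : NonUnitalStarSubalgebra ℂ (BoundedFamilies G) :=
  (NonUnitalStarAlgebra.adjoin ℂ (Set.range (universalRep μ))).topologicalClosure

/-- The full group `C*`-algebra `C*(G)`. As the image of `C_c(G)` under the universal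
representation is a `*`-algebra, this is the completion of the convolution algebra `C_c(G)` in the
norm `f ↦ sup_π ‖π(f)‖`, with `π` running over all unitary representations of `G`. -/
def GroupCStar : Type (u + 1) := groupCStarSubalgebra μ

instance : NonUnitalCStarAlgebra (GroupCStar μ) :=
  NonUnitalStarSubalgebra.nonUnitalCStarAlgebra (groupCStarSubalgebra μ)
    (h_closed := NonUnitalStarSubalgebra.isClosed_topologicalClosure _)

namespace GroupCStar

/-- The canonical map `C_c(G) → C*(G)`. -/
def ofCc (f : C_c(G, ℂ)) : GroupCStar μ :=
  ⟨universalRep μ f, NonUnitalStarSubalgebra.le_topologicalClosure _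
    (NonUnitalStarAlgebra.subset_adjoin ℂ _ ⟨f, rfl⟩)⟩

/-- The `*`-representation of `C*(G)` given by a unitary representation `π` of `G`. -/
def rep (π : UnitaryRep G) : GroupCStar μ →⋆ₙₐ[ℂ] (π.space →L[ℂ] π.space) where
  toFun a := a.1 π
  map_smul' _ _ := rfl
  map_zero' := rfl
  map_add' _ _ := rfl
  map_mul' _ _ := rfl
  map_star' _ := rfl

theorem rep_ofCc (π : UnitaryRep G) (f : C_c(G, ℂ)) : rep μ π (ofCc μ f) = π.integrated μ f := rfl

variable {μ} in
theorem ext_rep {a b : GroupCStar μ} (h : ∀ π, rep μ π a = rep μ π b) : a = b :=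
  Subtype.ext (lp.ext (funext h))

end GroupCStar

/-- The identification of the operators on a one-dimensional Hilbert space with scalars. -/
def oneDimScalar : (EuclideanSpace ℂ PUnit.{u + 1} →L[ℂ] EuclideanSpace ℂ PUnit.{u + 1}) →⋆ₙₐ[ℂ] ℂ
    where
  toFun T := T (WithLp.toLp 2 fun _ => 1) PUnit.unit
  map_smul' _ _ := by simp
  map_zero' := by simp
  map_add' _ _ := by simp
  map_mul' S T := by
    have h : ∀ ξ : EuclideanSpace ℂ PUnit.{u + 1},
        ξ = ξ PUnit.unit • WithLp.toLp 2 fun _ => (1 : ℂ) := fun ξ => by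
      ext j
      simp
    rw [mul_apply_eq_comp, h (T _), map_smul]
    simp [mul_comm]
  map_star' T := by
    have h := ContinuousLinearMap.adjoint_inner_right T
      (WithLp.toLp 2 fun _ => (1 : ℂ)) (WithLp.toLp 2 fun _ => (1 : ℂ))
    simpa [PiLp.inner_apply, ContinuousLinearMap.star_eq_adjoint] using h

/-- The trivial representation of `C*(G)`, as a character: the `*`-representation given by the
trivial representation of `G`. -/
def trivialCharacter : GroupCStar μ →⋆ₙₐ[ℂ] ℂ :=
  oneDimScalar.{u}.comp (GroupCStar.rep μ (UnitaryRep.trivialRep G))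

theorem trivialCharacter_ofCc (f : C_c(G, ℂ)) :
    trivialCharacter μ (GroupCStar.ofCc μ f) = ∫ g, f g ∂μ := by
  have h : (GroupCStar.rep μ (UnitaryRep.trivialRep G) (GroupCStar.ofCc μ f) :
      EuclideanSpace ℂ PUnit.{u + 1} →L[ℂ] EuclideanSpace ℂ PUnit.{u + 1}) (WithLp.toLp 2 fun _ => 1 : EuclideanSpace ℂ PUnit.{u + 1}) =
      ∫ g, f g • (WithLp.toLp 2 fun _ => 1 : EuclideanSpace ℂ PUnit.{u + 1}) ∂μ := rfl
  have h' := congrArg (fun ξ : EuclideanSpace ℂ PUnit.{u + 1} => ξ PUnit.unit) h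
  refine h'.trans ?_
  simp only
  rw [integral_smul_const]
  simp

/-- The characteristic function of a compact open subgroup, as an element of `C_c(G)`. -/
def subgroupIndicator (U : Subgroup G) (hc : IsCompact (U : Set G)) (ho : IsOpen (U : Set G))
    (hcl : IsClosed (U : Set G)) : C_c(G, ℂ) where
  toFun := Set.indicator (U : Set G) 1
  continuous_toFun := (continuous_one).indicator (by simp [IsClopen.frontier_eq ⟨hcl, ho⟩])
  hasCompactSupport' := HasCompactSupport.intro' hc hcl fun x hx => by simp [hx]

theorem integral_subgroupIndicator (U : Subgroup G) (hc : IsCompact (U : Set G))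
    (ho : IsOpen (U : Set G)) (hcl : IsClosed (U : Set G)) (hμ : μ U = 1) :
    ∫ g, subgroupIndicator U hc ho hcl g ∂μ = 1 := by
  change ∫ g, Set.indicator (U : Set G) (1 : G → ℂ) g ∂μ = 1
  rw [integral_indicator ho.measurableSet]
  simp [Measure.real, hμ]

variable [IsTopologicalGroup G]

/-- The element `p₀` of `C*(G)` given by the characteristic function of a compact open
subgroup. -/
def subgroupProj (U : Subgroup G) (hc : IsCompact (U : Set G)) (ho : IsOpen (U : Set G)) :
    GroupCStar μ :=
  GroupCStar.ofCc μ (subgroupIndicator U hc ho (U.isClosed_of_isOpen ho))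

theorem UnitaryRep.op_mul_integrated (π : UnitaryRep G) (U : Subgroup G)
    (hc : IsCompact (U : Set G)) (ho : IsOpen (U : Set G)) (hcl : IsClosed (U : Set G))
    {h : G} (hh : h ∈ U) (ξ : π.space) :
    π.op h (π.integrated μ (subgroupIndicator U hc ho hcl) ξ) =
      π.integrated μ (subgroupIndicator U hc ho hcl) ξ := by
  set f := subgroupIndicator U hc ho hcl with hf
  rw [integrated_apply, ← ContinuousLinearMap.integral_comp_comm _ (π.integrable_smul_op μ f ξ)]
  rw [← integral_mul_left_eq_self (fun g => f g • π.op g ξ) h]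
  refine integral_congr_ae (Filter.Eventually.of_forall fun g => ?_)
  have h1 : f (h * g) = f g := by
    change Set.indicator (U : Set G) 1 (h * g) = Set.indicator (U : Set G) 1 g
    by_cases hg : g ∈ U
    · rw [Set.indicator_of_mem (U.mul_mem hh hg), Set.indicator_of_mem hg]
      rfl
    · rw [Set.indicator_of_notMem fun hm => hg ((U.mul_mem_cancel_left hh).1 hm),
        Set.indicator_of_notMem hg]
  simp [h1, UnitaryRep.op]

theorem star_subgroupProj_mul (U : Subgroup G) (hc : IsCompact (U : Set G))
    (ho : IsOpen (U : Set G)) (hμ : μ U = 1) :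
    star (subgroupProj μ U hc ho) * subgroupProj μ U hc ho = subgroupProj μ U hc ho := by
  refine GroupCStar.ext_rep fun π => ?_
  have hcl := U.isClosed_of_isOpen ho
  set f := subgroupIndicator U hc ho hcl with hf
  have hrep : GroupCStar.rep μ π (subgroupProj μ U hc ho) = π.integrated μ f := rfl
  rw [map_mul, map_star, hrep]
  ext1 ξ
  refine ext_inner_left ℂ fun η => ?_
  rw [mul_apply_eq_comp, ContinuousLinearMap.star_eq_adjoint,
    ContinuousLinearMap.adjoint_inner_right, ← inner_conj_symm,
    UnitaryRep.integrated_apply μ π f η, ← integral_inner (π.integrable_smul_op μ f η)]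
  have hpt : ∀ g, ⟪π.integrated μ f ξ, f g • π.op g η⟫_ℂ =
      f g * ⟪π.integrated μ f ξ, η⟫_ℂ := by
    intro g
    rw [inner_smul_right]
    by_cases hg : g ∈ U
    · congr 1
      conv_lhs => rw [← π.op_mul_integrated μ U hc ho hcl hg ξ]
      have h : star (π.op g) * π.op g = 1 := Unitary.coe_star_mul_self (π.toHom g)
      rw [← ContinuousLinearMap.adjoint_inner_left, ← ContinuousLinearMap.star_eq_adjoint,
        ← mul_apply_eq_comp, h, one_apply_eq_self]
    · have : f g = 0 := by
        change Set.indicator (U : Set G) 1 g = 0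
        simp [hg]
      simp [this]
  have hint : ∫ g, f g ∂μ = 1 := integral_subgroupIndicator μ U hc ho hcl hμ
  simp only [hpt]
  rw [integral_mul_const, hint, one_mul, inner_conj_symm]

theorem isStarProjection_subgroupProj (U : Subgroup G) (hc : IsCompact (U : Set G))
    (ho : IsOpen (U : Set G)) (hμ : μ U = 1) : IsStarProjection (subgroupProj μ U hc ho) := by
  have h := star_subgroupProj_mul μ U hc ho hμ
  have hs : IsSelfAdjoint (subgroupProj μ U hc ho) := by
    rw [← h]
    exact IsSelfAdjoint.star_mul_self _
  refine ⟨?_, hs⟩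
  rw [hs.star_eq] at h
  exact h

end GroupCStar

/-! ### Corners -/

section Corner

variable {A : Type w} [NonUnitalCStarAlgebra A] {p : A}

/-- The corner `pAp`, for a projection `p`, as a `*`-subalgebra of `A`. -/
def cornerSubalgebra (hp : IsStarProjection p) : NonUnitalStarSubalgebra ℂ A where
  carrier := {x | ∃ a, x = p * a * p}
  add_mem' := by
    rintro _ _ ⟨a, rfl⟩ ⟨b, rfl⟩
    exact ⟨a + b, by simp [mul_add, add_mul]⟩
  zero_mem' := ⟨0, by simp⟩
  mul_mem' := by
    rintro _ _ ⟨a, rfl⟩ ⟨b, rfl⟩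
    exact ⟨a * p * p * b, by simp only [mul_assoc]⟩
  smul_mem' := by
    rintro c _ ⟨a, rfl⟩
    exact ⟨c • a, by simp [mul_smul_comm, smul_mul_assoc]⟩
  star_mem' := by
    rintro _ ⟨a, rfl⟩
    exact ⟨star a, by simp [mul_assoc, hp.isSelfAdjoint.star_eq]⟩

theorem mem_cornerSubalgebra (hp : IsStarProjection p) (x : A) :
    x ∈ cornerSubalgebra hp ↔ p * x = x ∧ x * p = x := by
  have hpp : p * p = p := hp.isIdempotentElem
  constructor
  · rintro ⟨a, rfl⟩
    exact ⟨by rw [← mul_assoc, ← mul_assoc, hpp], by rw [mul_assoc, hpp]⟩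
  · rintro ⟨h1, h2⟩
    exact ⟨x, by rw [h1, h2]⟩

theorem isClosed_cornerSubalgebra (hp : IsStarProjection p) :
    IsClosed (cornerSubalgebra hp : Set A) := by
  have : (cornerSubalgebra hp : Set A) = {x | p * x = x} ∩ {x | x * p = x} := by
    ext x
    exact mem_cornerSubalgebra hp x
  rw [this]
  exact (isClosed_eq (continuous_const_mul p) continuous_id).inter
    (isClosed_eq (continuous_mul_const p) continuous_id)

/-- The corner `pAp` of a `C*`-algebra `A`, for a projection `p`. -/
def Corner (hp : IsStarProjection p) : Type w := cornerSubalgebra hp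

instance (hp : IsStarProjection p) : NonUnitalCStarAlgebra (Corner hp) :=
  NonUnitalStarSubalgebra.nonUnitalCStarAlgebra (cornerSubalgebra hp)
    (h_closed := isClosed_cornerSubalgebra hp)

/-- The inclusion of the corner `pAp` in `A`. -/
def Corner.incl (hp : IsStarProjection p) : Corner hp →⋆ₙₐ[ℂ] A where
  toFun x := x.1
  map_smul' _ _ := rfl
  map_zero' := rfl
  map_add' _ _ := rfl
  map_mul' _ _ := rfl
  map_star' _ := rfl

end Corner

section GroupCorner

variable {G : Type u} [Group G] [TopologicalSpace G] [IsTopologicalGroup G] [MeasurableSpace G]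
  [BorelSpace G] (μ : Measure G) [μ.IsHaarMeasure]
  (U : Subgroup G) (hc : IsCompact (U : Set G)) (ho : IsOpen (U : Set G)) (hμ : μ U = 1)

/-- The corner `p₀C*(G)p₀` for the projection `p₀` given by the characteristic function of a compact
open subgroup `U` of measure one. -/
abbrev GroupCorner : Type (u + 1) := Corner (isStarProjection_subgroupProj μ U hc ho hμ)

/-- The trivial representation of `p₀C*(G)p₀`, as a character: the restriction of that of
`C*(G)`. -/
def cornerCharacter : GroupCorner μ U hc ho hμ →⋆ₙₐ[ℂ] ℂ :=
  (trivialCharacter μ).comp (Corner.incl _)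

theorem cornerCharacter_ne_zero : ∃ a, cornerCharacter μ U hc ho hμ a ≠ 0 := by
  have hp := isStarProjection_subgroupProj μ U hc ho hμ
  refine ⟨⟨subgroupProj μ U hc ho, (mem_cornerSubalgebra hp _).2
    ⟨hp.isIdempotentElem, hp.isIdempotentElem⟩⟩, ?_⟩
  change trivialCharacter μ (GroupCStar.ofCc μ _) ≠ 0
  rw [trivialCharacter_ofCc, integral_subgroupIndicator μ U hc ho _ hμ]
  exact one_ne_zero

/-- The point of the dual space of `p₀C*(G)p₀` given by the trivial representation. -/
def trivialPoint : DualSpace (GroupCorner μ U hc ho hμ) :=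
  Quotient.mk _ (IrreducibleRep.ofCharacter (cornerCharacter μ U hc ho hμ)
    (cornerCharacter_ne_zero μ U hc ho hμ))

end GroupCorner

end

/-! The trivial representation is isolated because `C*(G)`, for `G` the completion, contains a
Kazhdan projection: an element `p` that acts in every unitary representation as the orthogonal
projection `π.invProj` onto the invariant vectors. It satisfies `a * p = χ a • p = p * a` for the
trivial character `χ`, and `χ p = 1`. Hence `p` lies in the corner. If an irreducible `σ` of the
corner has `σ(p) ≠ 0`, then any nonzero `σ(p)η` is an eigenvector with character `χ`, so `σ` is the
trivial representation. The classes with `σ(p) ≠ 0` form the complement of `hull {p}`, which is open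
(`isOpen_singleton_ofCharacter`).

Both forms of property (T) yield the same weaker statement, and it suffices for producing `p`: a
finite set `F` and `ε > 0` such that every `U`-fixed vector orthogonal to the invariants is moved by
some `g ∈ F` by at least `ε` times its norm (`IsKazhdanPairRel`, with `U` the compact open
subgroup). If no such pair existed, a Hilbert direct sum of counterexamples would contradict
property (T).

Given `(F, ε)`, the average `t` of `(g + 1)/2` over `g ∈ F`, applied after the projection onto
`U`-fixed vectors, fixes the invariant vectors and contracts their complement by a factor `c < 1`
independent of the representation. The powers of `t` therefore converge in `C*(G)`, and their limit
is `p`. -/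

noncomputable section

/-! ### Constructions with unitary representations -/

namespace UnitaryRep

variable {G : Type u} [Group G] [TopologicalSpace G]

/-- The unitary representation given by a strongly continuous action by linear isometries. -/
def ofIsometries {H : Type u} [NormedAddCommGroup H] [InnerProductSpace ℂ H] [CompleteSpace H]
    (ρ : G → H →ₗᵢ[ℂ] H) (one : ∀ ξ, ρ 1 ξ = ξ) (mul : ∀ g h ξ, ρ (g * h) ξ = ρ g (ρ h ξ))
    (cont : ∀ ξ, Continuous fun g => ρ g ξ) : UnitaryRep G where
  space := H
  toHom :=
    { toFun := fun g => ⟨(ρ g).toContinuousLinearMap, by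
        have h1 : star (ρ g).toContinuousLinearMap * (ρ g).toContinuousLinearMap = 1 :=
          (ContinuousLinearMap.norm_map_iff_adjoint_comp_self _).1 (ρ g).norm_map
        have h2 : (ρ g).toContinuousLinearMap * (ρ g⁻¹).toContinuousLinearMap = 1 := by
          ext ξ
          change ρ g (ρ g⁻¹ ξ) = ξ
          rw [← mul, mul_inv_cancel, one]
        exact Unitary.mem_iff.2 ⟨h1, by rwa [left_inv_eq_right_inv h1 h2]⟩⟩
      map_one' := Subtype.ext (ContinuousLinearMap.ext one)
      map_mul' := fun g h => Subtype.ext (ContinuousLinearMap.ext (mul g h)) }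
  continuous_orbit := cont

theorem op_one_apply (π : UnitaryRep G) (ξ : π.space) : π.op 1 ξ = ξ := by
  simp [op]

theorem op_mul_apply (π : UnitaryRep G) (g h : G) (ξ : π.space) :
    π.op (g * h) ξ = π.op g (π.op h ξ) := by
  simp [op]

theorem norm_op_eq (π : UnitaryRep G) (g : G) (ξ : π.space) : ‖π.op g ξ‖ = ‖ξ‖ :=
  (ContinuousLinearMap.norm_map_iff_adjoint_comp_self (π.op g)).2
    (Unitary.coe_star_mul_self (π.toHom g)) ξ

/-- The operator `π(g)` as a linear isometry. -/
def opIsometry (π : UnitaryRep G) (g : G) : π.space →ₗᵢ[ℂ] π.space :=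
  ⟨(π.op g : π.space →ₗ[ℂ] π.space), π.norm_op_eq g⟩

theorem inner_op_op (π : UnitaryRep G) (g : G) (ξ η : π.space) :
    ⟪π.op g ξ, π.op g η⟫_ℂ = ⟪ξ, η⟫_ℂ :=
  (π.opIsometry g).inner_map_map ξ η

/-- The subspace of invariant vectors. -/
def invariants (π : UnitaryRep G) : Submodule ℂ π.space where
  carrier := {ξ | ∀ g, π.op g ξ = ξ}
  add_mem' hξ hη g := by rw [map_add, hξ g, hη g]
  zero_mem' g := map_zero _
  smul_mem' c ξ hξ g := by rw [map_smul, hξ g]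

theorem mem_invariants {π : UnitaryRep G} {ξ : π.space} :
    ξ ∈ π.invariants ↔ ∀ g, π.op g ξ = ξ := Iff.rfl

theorem isClosed_invariants (π : UnitaryRep G) : IsClosed (π.invariants : Set π.space) := by
  have : (π.invariants : Set π.space) = ⋂ g, {ξ | π.op g ξ = ξ} := by
    ext ξ
    simp [mem_invariants]
  rw [this]
  exact isClosed_iInter fun g => isClosed_eq (π.op g).continuous continuous_id

instance (π : UnitaryRep G) : CompleteSpace π.invariants :=
  π.isClosed_invariants.completeSpace_coe

theorem inner_op_of_mem_invariants {π : UnitaryRep G} {v : π.space} (hv : v ∈ π.invariants)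
    (g : G) (ξ : π.space) : ⟪v, π.op g ξ⟫_ℂ = ⟪v, ξ⟫_ℂ := by
  conv_lhs => rw [← hv g]
  exact π.inner_op_op g v ξ

/-- The subrepresentation on a closed invariant subspace. -/
def subrep (π : UnitaryRep G) (K : Submodule ℂ π.space) (hK : IsClosed (K : Set π.space))
    (hinv : ∀ g, ∀ ξ ∈ K, π.op g ξ ∈ K) : UnitaryRep G :=
  haveI : CompleteSpace K := hK.completeSpace_coe
  ofIsometries (H := K)
    (fun g => ⟨(π.op g : π.space →ₗ[ℂ] π.space).restrict (hinv g),
      fun ξ => π.norm_op_eq g ξ⟩)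
    (fun ξ => Subtype.ext (π.op_one_apply ξ))
    (fun g h ξ => Subtype.ext (π.op_mul_apply g h ξ))
    (fun ξ => (π.continuous_orbit ξ).subtype_mk _)

theorem op_mem_orthogonal_invariants (π : UnitaryRep G) (g : G) {ξ : π.space}
    (hξ : ξ ∈ π.invariantsᗮ) : π.op g ξ ∈ π.invariantsᗮ := by
  intro v hv
  rw [inner_op_of_mem_invariants hv]
  exact hξ v hv

/-- The subrepresentation on the orthogonal complement of the invariant vectors. -/
def reduced (π : UnitaryRep G) : UnitaryRep G :=
  π.subrep π.invariantsᗮ (Submodule.isClosed_orthogonal _)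
    fun g _ hξ => π.op_mem_orthogonal_invariants g hξ

theorem not_hasInvariantVector_reduced (π : UnitaryRep G) : ¬ π.reduced.HasInvariantVector := by
  rintro ⟨⟨ξ, hξ⟩, hne, hinv⟩
  refine hne (Subtype.ext ?_)
  have h : ξ ∈ π.invariants := fun g => congrArg Subtype.val (hinv g)
  exact inner_self_eq_zero.1 (hξ ξ h)

/-! ### Hilbert direct sums -/

section DirectSum

variable {I : Type u} (π : I → UnitaryRep G)

/-- The componentwise action of `g` on the Hilbert direct sum. -/
def directSumOp (g : G) :
    lp (fun i => (π i).space) 2 →ₗᵢ[ℂ] lp (fun i => (π i).space) 2 where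
  toFun ξ := ⟨fun i => (π i).op g (ξ i), by
    have h := lp.memℓp ξ
    rw [memℓp_gen_iff (by norm_num)] at h
    refine (memℓp_gen_iff (by norm_num)).2 ?_
    simpa only [norm_op_eq] using h⟩
  map_add' ξ η := by
    ext i
    exact map_add ((π i).op g) _ _
  map_smul' c ξ := by
    ext i
    exact map_smul ((π i).op g) _ _
  norm_map' ξ := by
    rw [lp.norm_eq_tsum_rpow (by norm_num), lp.norm_eq_tsum_rpow (by norm_num)]
    congr 2
    funext i
    exact congrArg (· ^ _) ((π i).norm_op_eq g (ξ i))

theorem directSumOp_apply (g : G) (ξ : lp (fun i => (π i).space) 2) (i : I) :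
    directSumOp π g ξ i = (π i).op g (ξ i) := rfl

theorem directSumOp_single [DecidableEq I] (g : G) (i : I) (ξ : (π i).space) :
    directSumOp π g (lp.single 2 i ξ) = lp.single 2 i ((π i).op g ξ) := by
  ext j
  rw [directSumOp_apply]
  by_cases h : j = i
  · subst h
    simp
  · simp [h]

/-- Finite partial sums have continuous orbit maps. As every operator is isometric, they approximate
the orbit map of `ξ` uniformly in `g`. -/
theorem continuous_directSumOp (ξ : lp (fun i => (π i).space) 2) :
    Continuous fun g => directSumOp π g ξ := by
  classical
  have hsum := lp.hasSum_single (by norm_num) ξ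
  have hunif : TendstoUniformly (fun (s : Finset I) (g : G) =>
      directSumOp π g (∑ i ∈ s, lp.single 2 i (ξ i))) (fun g => directSumOp π g ξ)
      Filter.atTop := by
    rw [Metric.tendstoUniformly_iff]
    intro ε hε
    filter_upwards [Metric.tendsto_nhds.1 hsum ε hε] with s hs g
    rwa [(directSumOp π g).dist_map, dist_comm]
  refine hunif.continuous (Filter.Frequently.of_forall fun s => ?_)
  simp only [map_sum, directSumOp_single]
  refine continuous_finsetSum _ fun i _ => ?_
  exact (lp.isometry_single (E := fun i => (π i).space) (p := 2) i).continuous.comp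
    ((π i).continuous_orbit (ξ i))

/-- The Hilbert direct sum of a family of unitary representations. -/
def directSum : UnitaryRep G :=
  ofIsometries (directSumOp π)
    (fun ξ => lp.ext (funext fun i => (π i).op_one_apply (ξ i)))
    (fun g h ξ => lp.ext (funext fun i => (π i).op_mul_apply g h (ξ i)))
    (continuous_directSumOp π)

theorem not_hasInvariantVector_directSum (h : ∀ i, ¬ (π i).HasInvariantVector) :
    ¬ (directSum π).HasInvariantVector := by
  rintro ⟨ξ, hne, hinv⟩
  refine hne (lp.ext (funext fun i => ?_))
  by_contra hi
  exact h i ⟨_, hi, fun g => congrFun (congrArg Subtype.val (hinv g)) i⟩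

/-- The embedding of a summand is isometric and intertwines the actions, so almost invariance of a
vector survives in the sum. -/
theorem exists_vector_directSum (i : I) (ξ : (π i).space) :
    ∃ η : (directSum π).space, ‖η‖ = ‖ξ‖ ∧
      ∀ g, ‖(directSum π).op g η - η‖ = ‖(π i).op g ξ - ξ‖ := by
  classical
  have hnorm : ∀ ζ : (π i).space, ‖lp.single (E := fun i => (π i).space) 2 i ζ‖ = ‖ζ‖ :=
    fun ζ => lp.norm_single (E := fun i => (π i).space) (p := 2) two_pos i ζ
  have hsub : ∀ g, ‖directSumOp π g (lp.single 2 i ξ) - lp.single 2 i ξ‖ =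
      ‖(π i).op g ξ - ξ‖ := fun g => by
    rw [directSumOp_single, ← lp.single_sub, hnorm]
  let η : lp (fun i => (π i).space) 2 := lp.single 2 i ξ
  exact ⟨η, hnorm ξ, hsub⟩

end DirectSum

/-- The restriction of a unitary representation along a homomorphism from a discrete group. -/
def pullback {D : Type u} [Group D] [TopologicalSpace D] [DiscreteTopology D] (ι : D →* G)
    (π : UnitaryRep G) : UnitaryRep D where
  space := π.space
  toHom := π.toHom.comp ι
  continuous_orbit _ := continuous_of_discreteTopology

/-- The orbit map of the vector is continuous and constant on the dense image of `ι`. -/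
theorem HasInvariantVector.of_pullback {D : Type u} [Group D] [TopologicalSpace D]
    [DiscreteTopology D] {ι : D →* G} (hι : DenseRange ι) {π : UnitaryRep G}
    (h : (π.pullback ι).HasInvariantVector) : π.HasInvariantVector := by
  obtain ⟨ξ, hne, hinv⟩ := h
  refine ⟨ξ, hne, fun g => ?_⟩
  exact congrFun (hι.equalizer (π.continuous_orbit ξ) continuous_const (funext hinv)) g

end UnitaryRep

/-! ### The spectral gap on vectors fixed by an open subgroup -/

section Gap

variable {G : Type u} [Group G] [TopologicalSpace G]

/-- `(F, ε)` is a Kazhdan pair for the `U`-fixed vectors of `G`. -/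
def IsKazhdanPairRel (U : Subgroup G) (F : Finset G) (ε : ℝ) : Prop :=
  ∀ π : UnitaryRep G, ∀ ξ ∈ π.invariantsᗮ, (∀ h ∈ U, π.op h ξ = ξ) →
    ∃ g ∈ F, ε * ‖ξ‖ ≤ ‖π.op g ξ - ξ‖

/-- If there is no Kazhdan pair for the `U`-fixed vectors, then some unitary representation without
invariant vectors has `U`-fixed almost invariant vectors. -/
theorem exists_unitaryRep_of_not_isKazhdanPairRel (U : Subgroup G)
    (h : ¬ ∃ F : Finset G, ∃ ε : ℝ, 0 < ε ∧ F.Nonempty ∧ IsKazhdanPairRel U F ε) :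
    ∃ π : UnitaryRep G, ¬ π.HasInvariantVector ∧ ∀ (F : Finset G) (ε : ℝ), 0 < ε →
      ∃ ξ : π.space, ‖ξ‖ = 1 ∧ (∀ h ∈ U, π.op h ξ = ξ) ∧ ∀ g ∈ F, ‖π.op g ξ - ξ‖ < ε := by
  classical
  -- One counterexample for each pair `(F, 1/(n+1))`. This index set lies in the universe of `G`, so
  -- the direct sum is again a `UnitaryRep G`.
  have key : ∀ i : Finset G × ℕ, ∃ π : UnitaryRep G, ¬ π.HasInvariantVector ∧
      ∃ ξ : π.space, ‖ξ‖ = 1 ∧ (∀ h ∈ U, π.op h ξ = ξ) ∧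
        ∀ g ∈ i.1, ‖π.op g ξ - ξ‖ < 1 / ((i.2 : ℝ) + 1) := by
    rintro ⟨F, n⟩
    have hn : (0 : ℝ) < 1 / ((n : ℝ) + 1) := Nat.one_div_pos_of_nat
    -- Adjoining `1` makes the finite set nonempty; the strict inequality at `1` then forces `ξ ≠
    -- 0`, so that `ξ` can be normalised.
    have hF : ¬ IsKazhdanPairRel U (insert 1 F) (1 / ((n : ℝ) + 1)) := fun hc =>
      h ⟨_, _, hn, Finset.insert_nonempty _ _, hc⟩
    simp only [IsKazhdanPairRel] at hF
    push Not at hF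
    obtain ⟨π, ξ, hξ, hU, hlt⟩ := hF
    refine ⟨π.reduced, π.not_hasInvariantVector_reduced, ?_⟩
    have hpos : 0 < ‖ξ‖ := by
      refine norm_pos_iff.2 fun h0 => ?_
      have := hlt 1 (Finset.mem_insert_self _ _)
      simp [h0] at this
    have hnorm : ‖((‖ξ‖⁻¹ : ℝ) : ℂ)‖ = ‖ξ‖⁻¹ := by
      rw [Complex.norm_real, norm_inv, norm_norm]
    refine ⟨(⟨((‖ξ‖⁻¹ : ℝ) : ℂ) • ξ, Submodule.smul_mem _ _ hξ⟩ : π.invariantsᗮ), ?_, ?_, ?_⟩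
    · change ‖((‖ξ‖⁻¹ : ℝ) : ℂ) • ξ‖ = 1
      rw [norm_smul, hnorm, inv_mul_cancel₀ hpos.ne']
    · intro g hg
      refine Subtype.ext ?_
      change π.op g (((‖ξ‖⁻¹ : ℝ) : ℂ) • ξ) = ((‖ξ‖⁻¹ : ℝ) : ℂ) • ξ
      rw [map_smul, hU g hg]
    · intro g hg
      change ‖π.op g (((‖ξ‖⁻¹ : ℝ) : ℂ) • ξ) - ((‖ξ‖⁻¹ : ℝ) : ℂ) • ξ‖ < _
      rw [map_smul, ← smul_sub, norm_smul, hnorm, inv_mul_lt_iff₀ hpos, mul_comm]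
      exact hlt g (Finset.mem_insert_of_mem hg)
  choose π hπ ξ hξ hU hlt using key
  refine ⟨UnitaryRep.directSum π, UnitaryRep.not_hasInvariantVector_directSum π hπ,
    fun F ε hε => ?_⟩
  obtain ⟨n, hn⟩ := exists_nat_one_div_lt hε
  obtain ⟨η, hη, hη'⟩ := UnitaryRep.exists_vector_directSum π (F, n) (ξ (F, n))
  refine ⟨η, hη.trans (hξ _), fun h hh => ?_, fun g hg => ?_⟩
  · rw [← sub_eq_zero, ← norm_eq_zero, hη' h, hU _ h hh, sub_self, norm_zero]
  · rw [hη' g]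
    exact (hlt (F, n) g hg).trans hn

/-- The orbit map of a `U`-fixed vector is constant on each coset `gU`. Finitely many of these open
cosets cover a compact set, so control on a finite set gives control on a compact one. -/
theorem exists_isKazhdanPairRel_of_hasPropertyT [IsTopologicalGroup G] (U : Subgroup G)
    (ho : IsOpen (U : Set G)) (hT : HasPropertyT G) :
    ∃ F : Finset G, ∃ ε : ℝ, 0 < ε ∧ F.Nonempty ∧ IsKazhdanPairRel U F ε := by
  by_contra hcon
  obtain ⟨π, hπ, hai⟩ := exists_unitaryRep_of_not_isKazhdanPairRel U hcon
  refine hπ (hT π fun Q hQ ε hε => ?_)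
  obtain ⟨F, hF⟩ := hQ.elim_finite_subcover (fun g : G => (fun x => g⁻¹ * x) ⁻¹' (U : Set G))
    (fun g => ho.preimage (continuous_const_mul _))
    (fun x _ => Set.mem_iUnion.2 ⟨x, by simp⟩)
  obtain ⟨ξ, h1, hU, hlt⟩ := hai F ε hε
  refine ⟨ξ, h1, fun x hx => ?_⟩
  obtain ⟨g, hg, hgx⟩ := Set.mem_iUnion₂.1 (hF hx)
  have : π.op x ξ = π.op g ξ := by
    rw [← mul_inv_cancel_left g x, π.op_mul_apply, hU _ hgx]
  rw [this]
  exact hlt g hg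

/-- A representation of `G` is restricted to `D`, where `U`-fixed vectors become `Γ`-fixed. Density
of the image carries the resulting `D`-invariant vector back to `G`. -/
theorem exists_isKazhdanPairRel_of_pairHasPropertyT {D : Type u} [Group D] [TopologicalSpace D]
    [DiscreteTopology D] (Γ : Subgroup D) (U : Subgroup G) (ι : D →* G) (hι : DenseRange ι)
    (hΓ : Γ ≤ U.comap ι) (hT : PairHasPropertyT D Γ) :
    ∃ F : Finset G, ∃ ε : ℝ, 0 < ε ∧ F.Nonempty ∧ IsKazhdanPairRel U F ε := by
  classical
  by_contra hcon
  obtain ⟨π, hπ, hai⟩ := exists_unitaryRep_of_not_isKazhdanPairRel U hcon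
  refine hπ (UnitaryRep.HasInvariantVector.of_pullback hι (hT _ fun Q hQ ε hε => ?_))
  have : DiscreteTopology (D ⧸ Γ) := QuotientGroup.discreteTopology (isOpen_discrete _)
  have hfin : Q.Finite := hQ.finite_of_discrete
  obtain ⟨ξ, h1, hU, hlt⟩ := hai (hfin.toFinset.image fun q => ι q.out) ε hε
  refine ⟨ξ, h1, fun h hh => hU _ (hΓ hh), fun g hg => ?_⟩
  obtain ⟨γ, hγ⟩ := QuotientGroup.mk_out_eq_mul Γ g
  -- The displacement of `ξ` depends only on the coset, so one representative for each point of the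
  -- finite set `Q` is enough.
  have h2 : π.op (ι (g : D ⧸ Γ).out) ξ = π.op (ι g) ξ := by
    rw [hγ, map_mul, π.op_mul_apply, hU _ (hΓ γ.2)]
  have h3 := hlt (ι (g : D ⧸ Γ).out)
    (Finset.mem_image_of_mem _ (hfin.mem_toFinset.2 hg))
  rw [h2] at h3
  exact h3

end Gap

end

noncomputable section

/-! ### Projections onto invariant vectors and their membership in `C*(G)` -/

section KazhdanProjection

variable {G : Type u} [Group G] [TopologicalSpace G] [MeasurableSpace G] [BorelSpace G]
  (μ : Measure G) [μ.IsHaarMeasure]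

namespace UnitaryRep

/-- The orthogonal projection onto the invariant vectors. -/
def invProj (π : UnitaryRep G) : π.space →L[ℂ] π.space := π.invariants.starProjection

theorem invProj_apply_mem (π : UnitaryRep G) (ξ : π.space) : π.invProj ξ ∈ π.invariants :=
  Submodule.starProjection_apply_mem _ _

theorem sub_invProj_mem (π : UnitaryRep G) (ξ : π.space) : ξ - π.invProj ξ ∈ π.invariantsᗮ :=
  Submodule.sub_starProjection_mem_orthogonal _

theorem invProj_eq_self (π : UnitaryRep G) {ξ : π.space} (hξ : ξ ∈ π.invariants) :
    π.invProj ξ = ξ :=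
  Submodule.starProjection_eq_self_iff.2 hξ

theorem star_invProj (π : UnitaryRep G) : star π.invProj = π.invProj :=
  isSelfAdjoint_starProjection π.invariants

theorem invProj_mul_self (π : UnitaryRep G) : π.invProj * π.invProj = π.invProj :=
  Submodule.isIdempotentElem_starProjection _

/-- Vectors `ξ` and `π(g)ξ` have the same inner products with invariant vectors, hence the same
projection. -/
theorem invProj_op (π : UnitaryRep G) (g : G) (ξ : π.space) :
    π.invProj (π.op g ξ) = π.invProj ξ := by
  refine Submodule.eq_starProjection_of_mem_orthogonal (π.invProj_apply_mem ξ) fun v hv => ?_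
  rw [inner_sub_right, inner_op_of_mem_invariants hv, ← inner_sub_right]
  exact π.sub_invProj_mem ξ v hv

theorem integrated_mul_invProj (π : UnitaryRep G) (f : C_c(G, ℂ)) :
    π.integrated μ f * π.invProj = (∫ g, f g ∂μ) • π.invProj := by
  ext ξ
  change π.integrated μ f (π.invProj ξ) = (∫ g, f g ∂μ) • π.invProj ξ
  rw [integrated_apply, ← integral_smul_const]
  exact integral_congr_ae (.of_forall fun g => congrArg (f g • ·) (π.invProj_apply_mem ξ g))

theorem invProj_mul_integrated (π : UnitaryRep G) (f : C_c(G, ℂ)) :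
    π.invProj * π.integrated μ f = (∫ g, f g ∂μ) • π.invProj := by
  ext ξ
  change π.invProj (π.integrated μ f ξ) = (∫ g, f g ∂μ) • π.invProj ξ
  rw [integrated_apply, ← ContinuousLinearMap.integral_comp_comm _ (π.integrable_smul_op μ f ξ),
    ← integral_smul_const]
  refine integral_congr_ae (.of_forall fun g => ?_)
  simp only [map_smul, invProj_op]

end UnitaryRep

/-- Given a `*`-homomorphism `φ : A → B`, a character `χ` of `A` and a self-adjoint `P : B`, the
`*`-subalgebra of all `x` for which `φ x` acts on `P`, from both sides, as the scalar `χ x`. -/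
def scalarSubalgebra {A B : Type*} [NonUnitalRing A] [StarRing A] [Module ℂ A]
    [NonUnitalRing B] [StarRing B] [Module ℂ B] [IsScalarTower ℂ B B] [SMulCommClass ℂ B B]
    [StarModule ℂ B] [StarModule ℂ A] (φ : A →⋆ₙₐ[ℂ] B) (χ : A →⋆ₙₐ[ℂ] ℂ) {P : B}
    (hP : star P = P) : NonUnitalStarSubalgebra ℂ A where
  carrier := {x | φ x * P = χ x • P ∧ P * φ x = χ x • P}
  add_mem' {x y} hx hy :=
    ⟨by rw [map_add, add_mul, hx.1, hy.1, map_add, add_smul],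
      by rw [map_add, mul_add, hx.2, hy.2, map_add, add_smul]⟩
  zero_mem' :=
    ⟨by rw [map_zero, zero_mul, map_zero, zero_smul],
      by rw [map_zero, mul_zero, map_zero, zero_smul]⟩
  mul_mem' {x y} hx hy :=
    ⟨by rw [map_mul, mul_assoc, hy.1, mul_smul_comm, hx.1, map_mul, smul_smul, mul_comm],
      by rw [map_mul, ← mul_assoc, hx.2, smul_mul_assoc, hy.2, map_mul, smul_smul]⟩
  smul_mem' c x hx :=
    ⟨by rw [map_smul, smul_mul_assoc, hx.1, map_smul, smul_assoc],
      by rw [map_smul, mul_smul_comm, hx.2, map_smul, smul_assoc]⟩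
  star_mem' {x} hx := by
    refine ⟨?_, ?_⟩
    · have h := congrArg star hx.2
      rwa [star_mul, hP, star_smul, hP, ← map_star, ← map_star] at h
    · have h := congrArg star hx.1
      rwa [star_mul, hP, star_smul, hP, ← map_star, ← map_star] at h

namespace BoundedFamilies

theorem continuous_apply (π : UnitaryRep G) : Continuous fun x : BoundedFamilies G => x π := by
  refine LipschitzWith.continuous (K := 1) (LipschitzWith.of_dist_le_mul fun x y => ?_)
  rw [NNReal.coe_one, one_mul, dist_eq_norm, dist_eq_norm]
  exact lp.norm_apply_le_norm ENNReal.top_ne_zero (x - y) π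

/-- The evaluation of a bounded family at a unitary representation. -/
def evalAt (π : UnitaryRep G) : BoundedFamilies G →⋆ₙₐ[ℂ] (π.space →L[ℂ] π.space) where
  toFun x := x π
  map_smul' _ _ := rfl
  map_zero' := rfl
  map_add' _ _ := rfl
  map_mul' _ _ := rfl
  map_star' _ := rfl

variable (G) in
/-- The scalar by which a bounded family acts in the trivial representation. -/
def trivialScalar : BoundedFamilies G →⋆ₙₐ[ℂ] ℂ :=
  oneDimScalar.{u}.comp (evalAt (UnitaryRep.trivialRep G))

variable (G) in
theorem continuous_trivialScalar : Continuous (trivialScalar G) := by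
  let v : EuclideanSpace ℂ PUnit.{u + 1} := WithLp.toLp 2 fun _ => 1
  have h : Continuous fun T : EuclideanSpace ℂ PUnit.{u + 1} →L[ℂ] EuclideanSpace ℂ PUnit.{u + 1} =>
      T v PUnit.unit :=
    (EuclideanSpace.proj PUnit.unit : EuclideanSpace ℂ PUnit.{u + 1} →L[ℂ] ℂ).continuous.comp
      (continuous_id.clm_apply continuous_const)
  exact h.comp (continuous_apply (UnitaryRep.trivialRep G))

end BoundedFamilies

namespace GroupCStar

/-- For `a` in the image of `C_c(G)` both relations follow by integration. They define a closed
`*`-subalgebra, hence hold on all of `C*(G)`. The two sides are treated together because the adjoint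
exchanges them. -/
theorem rep_mul_invProj_and (π : UnitaryRep G) (a : GroupCStar μ) :
    rep μ π a * π.invProj = trivialCharacter μ a • π.invProj ∧
      π.invProj * rep μ π a = trivialCharacter μ a • π.invProj := by
  let S := scalarSubalgebra (BoundedFamilies.evalAt π) (BoundedFamilies.trivialScalar G)
    π.star_invProj
  have hχ : Continuous fun x : BoundedFamilies G =>
      BoundedFamilies.trivialScalar G x • π.invProj :=
    (BoundedFamilies.continuous_trivialScalar G).smul continuous_const
  have hcl : IsClosed (S : Set (BoundedFamilies G)) :=
    (isClosed_eq ((BoundedFamilies.continuous_apply π).mul continuous_const) hχ).inter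
      (isClosed_eq (continuous_const.mul (BoundedFamilies.continuous_apply π)) hχ)
  have hle : groupCStarSubalgebra μ ≤ S := by
    refine NonUnitalStarSubalgebra.topologicalClosure_minimal _
      (NonUnitalStarAlgebra.adjoin_le ?_) hcl
    rintro _ ⟨f, rfl⟩
    have h : BoundedFamilies.trivialScalar G (universalRep μ f) = ∫ g, f g ∂μ :=
      trivialCharacter_ofCc μ f
    exact ⟨(π.integrated_mul_invProj μ f).trans (by rw [h]),
      (π.invProj_mul_integrated μ f).trans (by rw [h])⟩
  exact hle a.2

theorem rep_mul_invProj (π : UnitaryRep G) (a : GroupCStar μ) :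
    rep μ π a * π.invProj = trivialCharacter μ a • π.invProj :=
  (rep_mul_invProj_and μ π a).1

theorem invProj_mul_rep (π : UnitaryRep G) (a : GroupCStar μ) :
    π.invProj * rep μ π a = trivialCharacter μ a • π.invProj :=
  (rep_mul_invProj_and μ π a).2

/-- The family of the projections onto the invariant vectors belongs to `C*(G)` as soon as it is
separated from the rest of the spectrum by an element on which the trivial representation takes the
value one. -/
theorem exists_rep_eq_invProj (t : GroupCStar μ) (ht : trivialCharacter μ t = 1) {c : ℝ}
    (hc0 : 0 ≤ c) (hc : c < 1)
    (hgap : ∀ (π : UnitaryRep G), ∀ ξ ∈ π.invariantsᗮ, ‖rep μ π t ξ‖ ≤ c * ‖ξ‖) :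
    ∃ p : GroupCStar μ, ∀ π, rep μ π p = π.invProj := by
  -- With `T = π(t)` and `P` the projection, `TP = P` gives `T - P = T(1 - P)`, and `1 - P` is a
  -- contraction onto the complement.
  have hdiff : ∀ π : UnitaryRep G, ‖rep μ π t - π.invProj‖ ≤ c := fun π => by
    refine ContinuousLinearMap.opNorm_le_bound _ hc0 fun ξ => ?_
    have h1 : (rep μ π t - π.invProj) ξ = rep μ π t (ξ - π.invProj ξ) := by
      have := congrArg (fun T : π.space →L[ℂ] π.space => T ξ) (rep_mul_invProj μ π t)
      rw [ht, one_smul] at this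
      rw [map_sub, sub_apply]
      exact congrArg (_ - ·) this.symm
    rw [h1]
    refine (hgap π _ (π.sub_invProj_mem ξ)).trans (mul_le_mul_of_nonneg_left ?_ hc0)
    have h2 := Submodule.starProjection_orthogonal_val (K := π.invariants) ξ
    change ‖ξ - π.invariants.starProjection ξ‖ ≤ ‖ξ‖
    rw [← h2]
    exact Submodule.norm_starProjection_apply_le _ _
  -- Here `x n` is the power `t ^ (n + 1)`, starting at `t` because the algebra is not assumed
  -- unital. From `TP = PT = P` follows `T ^ (n + 1) - P = (T - P) ^ (n + 1)`.
  let x : ℕ → GroupCStar μ := fun n => Nat.rec t (fun _ y => t * y) n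
  have hx : ∀ n π, ‖rep μ π (x n) - π.invProj‖ ≤ c ^ (n + 1) ∧
      π.invProj * rep μ π (x n) = π.invProj := by
    intro n π
    induction n with
    | zero =>
      have h0 : x 0 = t := rfl
      rw [h0, zero_add, pow_one, invProj_mul_rep, ht, one_smul]
      exact ⟨hdiff π, rfl⟩
    | succ n ih =>
      have h1 : rep μ π (x (n + 1)) = rep μ π t * rep μ π (x n) := map_mul _ _ _
      have h2 : rep μ π t * π.invProj = π.invProj := by rw [rep_mul_invProj, ht, one_smul]
      have h3 : π.invProj * rep μ π t = π.invProj := by rw [invProj_mul_rep, ht, one_smul]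
      refine ⟨?_, by rw [h1, ← mul_assoc, h3, ih.2]⟩
      have h4 : rep μ π (x (n + 1)) - π.invProj =
          (rep μ π t - π.invProj) * (rep μ π (x n) - π.invProj) := by
        rw [h1, sub_mul, mul_sub, mul_sub, h2, ih.2, π.invProj_mul_self, sub_self, sub_zero]
      rw [h4, pow_succ']
      exact (norm_mul_le _ _).trans
        (mul_le_mul (hdiff π) ih.1 (norm_nonneg _) hc0)
  let p : BoundedFamilies G := ⟨fun π => π.invProj, memℓp_infty ⟨1, by
    rintro _ ⟨π, rfl⟩
    exact Submodule.starProjection_norm_le _⟩⟩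
  -- The bound `c ^ (n + 1)` is uniform in `π`, so the powers converge in the supremum norm, in
  -- which `C*(G)` is closed.
  have hp : p ∈ groupCStarSubalgebra μ := by
    have hcl : IsClosed (groupCStarSubalgebra μ : Set (BoundedFamilies G)) :=
      NonUnitalStarSubalgebra.isClosed_topologicalClosure _
    refine hcl.mem_of_tendsto (f := fun n => (x n).1) (b := Filter.atTop) ?_
      (.of_forall fun n => (x n).2)
    rw [tendsto_iff_norm_sub_tendsto_zero]
    refine squeeze_zero (fun _ => norm_nonneg _) (fun n => ?_)
      ((tendsto_pow_atTop_nhds_zero_of_lt_one hc0 hc).comp (Filter.tendsto_add_atTop_nat 1))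
    exact lp.norm_le_of_forall_le (pow_nonneg hc0 _) fun π => (hx n π).1
  exact ⟨⟨p, hp⟩, fun π => rfl⟩

end GroupCStar

/-! ### The averaging element of a Kazhdan pair -/

variable [IsTopologicalGroup G]

/-- The left translate `x ↦ f (g⁻¹ x)` of a compactly supported function. -/
def CompactlySupportedContinuousMap.leftTranslate (g : G) (f : C_c(G, ℂ)) : C_c(G, ℂ) where
  toFun x := f (g⁻¹ * x)
  continuous_toFun := f.continuous.comp (continuous_const_mul g⁻¹)
  hasCompactSupport' := f.hasCompactSupport.comp_homeomorph (Homeomorph.mulLeft g⁻¹)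

theorem UnitaryRep.integrated_leftTranslate (π : UnitaryRep G) (g : G) (f : C_c(G, ℂ))
    (ξ : π.space) : π.integrated μ (f.leftTranslate g) ξ = π.op g (π.integrated μ f ξ) := by
  rw [integrated_apply, integrated_apply,
    ← ContinuousLinearMap.integral_comp_comm _ (π.integrable_smul_op μ f ξ),
    ← integral_mul_left_eq_self _ g]
  refine integral_congr_ae (.of_forall fun x => ?_)
  change f (g⁻¹ * (g * x)) • π.op (g * x) ξ = π.op g (f x • π.op x ξ)
  rw [inv_mul_cancel_left, map_smul, op_mul_apply]

/-- By the parallelogram law a displacement costs norm in the sum. For `ε > 2` the root takes its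
default value `0`, which is consistent since the hypotheses then force `ξ = 0`. -/
theorem norm_add_le_sqrt_mul {H : Type*} [NormedAddCommGroup H] [InnerProductSpace ℂ H] {ε : ℝ}
    (hε : 0 ≤ ε) {ξ η : H} (hη : ‖η‖ = ‖ξ‖) (h : ε * ‖ξ‖ ≤ ‖η - ξ‖) :
    ‖η + ξ‖ ≤ √(4 - ε ^ 2) * ‖ξ‖ := by
  have hpar := parallelogram_law_with_norm ℂ η ξ
  rw [hη] at hpar
  have hsq : (ε * ‖ξ‖) ^ 2 ≤ ‖η - ξ‖ ^ 2 := by gcongr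
  have hb : ‖η + ξ‖ ^ 2 ≤ (4 - ε ^ 2) * ‖ξ‖ ^ 2 := by nlinarith
  rw [← Real.sqrt_sq (norm_nonneg (η + ξ))]
  refine (Real.sqrt_le_sqrt hb).trans (le_of_eq ?_)
  rw [Real.sqrt_mul' _ (sq_nonneg _), Real.sqrt_sq (norm_nonneg _)]

/-- A Kazhdan pair for the `U`-fixed vectors gives a Kazhdan projection in `C*(G)`. -/
theorem IsKazhdanPairRel.exists_rep_eq_invProj {U : Subgroup G} (hc : IsCompact (U : Set G))
    (ho : IsOpen (U : Set G)) (hμ : μ U = 1) {F : Finset G} {ε : ℝ} (hε : 0 < ε)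
    (hF : F.Nonempty) (hK : IsKazhdanPairRel U F ε) :
    ∃ p : GroupCStar μ, ∀ π, GroupCStar.rep μ π p = π.invProj := by
  classical
  have hcl := U.isClosed_of_isOpen ho
  set f := subgroupIndicator U hc ho hcl with hf
  have hf1 : trivialCharacter μ (GroupCStar.ofCc μ f) = 1 := by
    rw [trivialCharacter_ofCc, integral_subgroupIndicator μ U hc ho hcl hμ]
  have hfg : ∀ g, trivialCharacter μ (GroupCStar.ofCc μ (f.leftTranslate g)) = 1 := fun g => by
    rw [← hf1, trivialCharacter_ofCc, trivialCharacter_ofCc]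
    exact integral_mul_left_eq_self f g⁻¹
  have hN : (0 : ℝ) < F.card := Nat.cast_pos.2 hF.card_pos
  have hs2 : √(4 - ε ^ 2) < 2 := by
    rw [Real.sqrt_lt' two_pos]
    nlinarith
  -- With `η = π(f)ξ`, the `U`-fixed part of `ξ`, this element sends `ξ` to the mean over `F` of
  -- `(π(g)η + η)/2`. The summand `η` turns displacement by `g` into loss of norm.
  let t : GroupCStar μ := ((2 * F.card : ℝ)⁻¹ : ℂ) •
    ∑ g ∈ F, (GroupCStar.ofCc μ (f.leftTranslate g) + GroupCStar.ofCc μ f)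
  refine GroupCStar.exists_rep_eq_invProj μ t ?_
    -- All but one of the terms `π(g)η + η` get the trivial bound `2‖η‖`; the one for the element
    -- that moves `η` gets `√(4 - ε ^ 2) * ‖η‖`, strictly smaller if `η ≠ 0`.
    (c := (2 * F.card : ℝ)⁻¹ * (2 * (F.card - 1) + √(4 - ε ^ 2))) ?_ ?_ fun π ξ hξ => ?_
  · simp only [t, map_smul, map_sum, map_add, hfg, hf1, Finset.sum_const]
    have : (F.card : ℂ) ≠ 0 := Nat.cast_ne_zero.2 hF.card_pos.ne'
    rw [nsmul_eq_mul, smul_eq_mul]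
    push_cast
    field_simp
    norm_num
  · have : (1 : ℝ) ≤ F.card := Nat.one_le_cast.2 hF.card_pos
    have := Real.sqrt_nonneg (4 - ε ^ 2)
    refine mul_nonneg (by positivity) (by linarith)
  · rw [inv_mul_lt_iff₀ (by positivity)]
    linarith
  · set η := π.integrated μ f ξ with hη
    have hηU : ∀ h ∈ U, π.op h η = η := fun h hh => π.op_mul_integrated μ U hc ho hcl hh ξ
    -- Since `f` has integral one, `η` and `ξ` have the same projection onto the invariants, namely
    -- `0`.
    have hηP : η ∈ π.invariantsᗮ := by
      have h1 : π.invProj η = π.invProj ξ := by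
        have := congrArg (fun T : π.space →L[ℂ] π.space => T ξ) (π.invProj_mul_integrated μ f)
        rw [integral_subgroupIndicator μ U hc ho hcl hμ, one_smul] at this
        exact this
      have h2 : π.invProj ξ = 0 := Submodule.starProjection_apply_eq_zero_iff _ |>.2 hξ
      exact Submodule.starProjection_apply_eq_zero_iff _ |>.1 (h1.trans h2)
    have hηξ : ‖η‖ ≤ ‖ξ‖ := by
      refine (π.norm_integral_le μ f ξ).trans (le_of_eq ?_)
      have : ∫ g, ‖f g‖ ∂μ = 1 := by
        have h1 : ∀ g, ‖f g‖ = Set.indicator (U : Set G) 1 g := fun g => by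
          change ‖Set.indicator (U : Set G) (1 : G → ℂ) g‖ = _
          by_cases hg : g ∈ U <;> simp [hg]
        simp only [h1]
        rw [integral_indicator ho.measurableSet]
        simp [Measure.real, hμ]
      rw [this, one_mul]
    have htξ : GroupCStar.rep μ π t ξ = ((2 * F.card : ℝ)⁻¹ : ℂ) • ∑ g ∈ F, (π.op g η + η) := by
      simp only [t, map_smul, map_sum, map_add, GroupCStar.rep_ofCc]
      rw [smul_apply, sum_apply]
      simp only [add_apply, π.integrated_leftTranslate μ, ← hη]
    obtain ⟨g₀, hg₀, hgap⟩ := hK π η hηP hηU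
    have hsum : ‖∑ g ∈ F, (π.op g η + η)‖ ≤ (2 * (F.card - 1) + √(4 - ε ^ 2)) * ‖η‖ := by
      rw [← Finset.sum_erase_add _ _ hg₀, add_mul]
      refine (norm_add_le _ _).trans (add_le_add ?_ ?_)
      · refine (norm_sum_le_of_le _ (f := fun g => π.op g η + η) (n := fun _ => 2 * ‖η‖)
          fun g _ => ?_).trans (le_of_eq ?_)
        · refine (norm_add_le _ _).trans (le_of_eq ?_)
          rw [π.norm_op_eq, two_mul]
        · rw [Finset.sum_const, Finset.card_erase_of_mem hg₀, nsmul_eq_mul,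
            Nat.cast_sub hF.card_pos, Nat.cast_one]
          ring
      · exact norm_add_le_sqrt_mul hε.le (π.norm_op_eq g₀ η) hgap
    have hnonneg : 0 ≤ 2 * ((F.card : ℝ) - 1) + √(4 - ε ^ 2) := by
      have : (1 : ℝ) ≤ F.card := Nat.one_le_cast.2 hF.card_pos
      have := Real.sqrt_nonneg (4 - ε ^ 2)
      linarith
    rw [htξ, norm_smul, mul_assoc]
    have hnorm : ‖((2 * F.card : ℝ)⁻¹ : ℂ)‖ = (2 * F.card : ℝ)⁻¹ := by
      rw [norm_inv, Complex.norm_real, Real.norm_of_nonneg (by positivity)]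
    rw [hnorm]
    exact mul_le_mul_of_nonneg_left
      (hsum.trans (mul_le_mul_of_nonneg_left hηξ hnonneg)) (by positivity)

end KazhdanProjection

/-! ### Isolated points of the dual space -/

section Isolated

variable {A : Type w} [NonUnitalRing A] [StarRing A] [Module ℂ A]

/-- A common eigenvector spans a closed invariant line, which by irreducibility is the whole space.
-/
theorem IrreducibleRep.unitarilyEquiv_ofCharacter (σ : IrreducibleRep A) (χ : A →⋆ₙₐ[ℂ] ℂ)
    (hχ : ∃ a, χ a ≠ 0) {ξ : σ.space} (hξ : ξ ≠ 0) (h : ∀ a, σ.toHom a ξ = χ a • ξ) :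
    σ.UnitarilyEquiv (IrreducibleRep.ofCharacter χ hχ) := by
  have hspan : (ℂ ∙ ξ) = ⊤ := by
    refine (σ.irreducible (ℂ ∙ ξ) (Submodule.closed_of_finiteDimensional _) ?_).resolve_left
      fun hb => hξ (Submodule.span_singleton_eq_bot.1 hb)
    intro a η hη
    obtain ⟨c, rfl⟩ := Submodule.mem_span_singleton.1 hη
    rw [map_smul, h]
    exact Submodule.smul_mem _ _ (Submodule.smul_mem _ _ (Submodule.mem_span_singleton_self ξ))
  have hfin : Module.finrank ℂ σ.space = 1 := by
    rw [← finrank_top, ← hspan, finrank_span_singleton hξ]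
  have hfd : FiniteDimensional ℂ σ.space := Module.finite_of_finrank_eq_succ hfin
  let U : σ.space ≃ₗᵢ[ℂ] EuclideanSpace ℂ PUnit.{w + 1} :=
    ((stdOrthonormalBasis ℂ σ.space).reindex (Fintype.equivOfCardEq (by simp [hfin]))).repr
  refine ⟨U, fun a η => ?_⟩
  obtain ⟨c, rfl⟩ := Submodule.mem_span_singleton.1 (hspan ▸ Submodule.mem_top : η ∈ (ℂ ∙ ξ))
  have h1 : σ.toHom a (c • ξ) = χ a • (c • ξ) := by rw [map_smul, h, smul_comm]
  rw [h1]
  exact map_smul U _ _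

/-- A character is an isolated point of the dual space if it is supported by an element on which the
algebra acts by that character. -/
theorem isOpen_singleton_ofCharacter (χ : A →⋆ₙₐ[ℂ] ℂ) (hχ : ∃ a, χ a ≠ 0) {p : A}
    (hp : χ p ≠ 0) (hmul : ∀ a, a * p = χ a • p) :
    IsOpen ({Quotient.mk _ (IrreducibleRep.ofCharacter χ hχ)} : Set (DualSpace A)) := by
  refine isOpen_induced_iff.2 ⟨(hull {p})ᶜ, ?_, ?_⟩
  · change (hull {p})ᶜᶜ ∈ Set.range (hull (A := A))
    exact ⟨{p}, (compl_compl _).symm⟩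
  · ext x
    induction x using Quotient.inductionOn with
    | h σ =>
      have hx : Quotient.mk _ σ ∈ DualSpace.toPrim A ⁻¹' (hull {p})ᶜ ↔ σ.toHom p ≠ 0 := by
        change ¬ (∀ a ∈ ({p} : Set A), a ∈ σ.ker) ↔ _
        rw [ne_eq, ← σ.mem_ker]
        simp
      refine hx.trans ?_
      change _ ↔ Quotient.mk (irreducibleRepSetoid A) σ =
        Quotient.mk _ (IrreducibleRep.ofCharacter χ hχ)
      constructor
      · intro hσ
        obtain ⟨η, hη⟩ : ∃ η, σ.toHom p η ≠ 0 := by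
          by_contra! hcon
          exact hσ (ContinuousLinearMap.ext hcon)
        -- The relation `a * p = χ a • p` makes `σ(p)η` a common eigenvector with character `χ`.
        refine Quotient.sound (σ.unitarilyEquiv_ofCharacter χ hχ hη fun a => ?_)
        have h1 : σ.toHom a * σ.toHom p = χ a • σ.toHom p := by
          rw [← map_mul, hmul, map_smul]
        exact congrArg (fun T : σ.space →L[ℂ] σ.space => T η) h1
      · intro hσ h0
        have hker := (Quotient.exact hσ : σ.UnitarilyEquiv _).ker_eq
        have h1 : p ∈ (IrreducibleRep.ofCharacter χ hχ).ker := hker ▸ (σ.mem_ker p).2 h0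
        rw [IrreducibleRep.mem_ker] at h1
        have h2 : χ p • (1 : ℂ) = 0 := congrArg (fun T : EuclideanSpace ℂ PUnit.{w + 1} →L[ℂ]
          EuclideanSpace ℂ PUnit.{w + 1} => T (WithLp.toLp 2 fun _ => 1) PUnit.unit) h1
        exact hp (by simpa using h2)

end Isolated

/-! ### The Kazhdan projection in the corner -/

section

variable {G : Type u} [Group G] [TopologicalSpace G] [IsTopologicalGroup G] [MeasurableSpace G]
  [BorelSpace G] (μ : Measure G) [μ.IsHaarMeasure]
  (U : Subgroup G) (hc : IsCompact (U : Set G)) (ho : IsOpen (U : Set G))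

theorem trivialCharacter_subgroupProj (hμ : μ U = 1) :
    trivialCharacter μ (subgroupProj μ U hc ho) = 1 :=
  (trivialCharacter_ofCc μ _).trans
    (integral_subgroupIndicator μ U hc ho (U.isClosed_of_isOpen ho) hμ)

/-- If `C*(G)` contains a Kazhdan projection, then the trivial representation of the corner is an
isolated point. -/
theorem isOpen_singleton_trivialPoint (hμ : μ U = 1) (p : GroupCStar μ)
    (hp : ∀ π, GroupCStar.rep μ π p = π.invProj) :
    IsOpen ({trivialPoint μ U hc ho hμ} : Set (DualSpace (GroupCorner μ U hc ho hμ))) := by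
  have hmul : ∀ a : GroupCStar μ, a * p = trivialCharacter μ a • p := fun a =>
    GroupCStar.ext_rep fun π => by rw [map_mul, map_smul, hp, GroupCStar.rep_mul_invProj]
  have hmul' : ∀ a : GroupCStar μ, p * a = trivialCharacter μ a • p := fun a =>
    GroupCStar.ext_rep fun π => by rw [map_mul, map_smul, hp, GroupCStar.invProj_mul_rep]
  have hχ := trivialCharacter_subgroupProj μ U hc ho hμ
  have hpU := isStarProjection_subgroupProj μ U hc ho hμ
  -- The trivial character is `1` on `p₀`, so `p₀ * p = p = p * p₀`.
  let q : GroupCorner μ U hc ho hμ := ⟨p, (mem_cornerSubalgebra hpU p).2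
    ⟨by rw [hmul, hχ, one_smul], by rw [hmul', hχ, one_smul]⟩⟩
  -- In the trivial representation every vector is invariant, so `p` acts as the identity.
  have hq : cornerCharacter μ U hc ho hμ q = 1 := by
    change oneDimScalar (GroupCStar.rep μ (UnitaryRep.trivialRep G) p) = 1
    rw [hp]
    let v : EuclideanSpace ℂ PUnit.{u + 1} := WithLp.toLp 2 fun _ => 1
    have hv : (UnitaryRep.trivialRep G).invProj v = v :=
      (UnitaryRep.trivialRep G).invProj_eq_self fun _ => rfl
    exact congrArg (fun ξ : EuclideanSpace ℂ PUnit.{u + 1} => ξ PUnit.unit) hv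
  refine isOpen_singleton_ofCharacter (cornerCharacter μ U hc ho hμ)
    (cornerCharacter_ne_zero μ U hc ho hμ) (p := q) (by rw [hq]; exact one_ne_zero) fun a => ?_
  exact Subtype.ext (hmul a.1)

end

end

theorem mainTheorem7 {G : Type u} [Group G] [TopologicalSpace G] [DiscreteTopology G]
    (Γ : Subgroup G) (hΓ : IsHeckePair Γ)
    {Gb : Type u} [Group Gb] [TopologicalSpace Gb] [IsTopologicalGroup Gb] [T2Space Gb]
    [LocallyCompactSpace Gb] [TotallyDisconnectedSpace Gb]
    [MeasurableSpace Gb] [BorelSpace Gb]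
    (Γb : Subgroup Gb) (ι : G →* Gb) (hι : IsSchlichtingCompletion Γ Γb ι)
    (μ : Measure Gb) [μ.IsHaarMeasure] (hμ : μ Γb = 1)
    (hT : HasPropertyT Gb ∨ PairHasPropertyT G Γ) :
    IsOpen ({trivialPoint μ Γb hι.isCompact hι.isOpen hμ} :
      Set (DualSpace (GroupCorner μ Γb hι.isCompact hι.isOpen hμ))) := by
  obtain ⟨F, ε, hε, hF, hK⟩ : ∃ F : Finset Gb, ∃ ε : ℝ, 0 < ε ∧ F.Nonempty ∧
      IsKazhdanPairRel Γb F ε := by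
    rcases hT with hT | hT
    · exact exists_isKazhdanPairRel_of_hasPropertyT Γb hι.isOpen hT
    · exact exists_isKazhdanPairRel_of_pairHasPropertyT Γ Γb ι hι.denseRange hι.comap_eq.ge hT
  obtain ⟨p, hp⟩ := hK.exists_rep_eq_invProj μ hι.isCompact hι.isOpen hμ hε hF
  exact isOpen_singleton_trivialPoint μ Γb hι.isCompact hι.isOpen hμ p hp
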